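/- Let $N, D \in \mathbb{N}$. For a multi-index $\alpha\in\mathbb{N}^D$ put $|\alpha|=\sum_d\alpha_d$, and for $X=(x_{dn})\in\mathbb{C}^{D\times 2N}$ let $$\mathbf p_\alpha(X)=\frac1{\sqrt{|\alpha|}}\sum_{n=1}^{2N}\prod_{d=1}^D x_{dn}^{\alpha_d}\quad(\alpha\ne0),\qquad \mathbf p_0=1,$$ be the normalized multisymmetric power sums. Let $y\in(S^1)^N$ be random with density $\frac1{N!}\prod_{1\le i<j\le N}|y_j-y_i|^2$ with respect to the uniform probability measure on the torus $(S^1)^N$ (the joint eigenvalue law of a Haar-distributed unitary $N\times N$ matrix), let $q,r\in(S^1)^D$ have i.i.d. entries uniform on the unit circle $S^1$, with $y,q,r$ independent, and let $X\in\mathbb{C}^{D\times 2N}$ have entries $x_{dn}=q_dy_n$ for $1\le n\le N$ and $x_{dn}=r_dy_{n-N}$ for $N+1\le n\le 2N$. Put $\langle f,g\rangle_{\mathcal A}=\mathbb{E}[f(X)\overline{g(X)}]$, let $\langle f,g\rangle_{\mathcal A_0}$ be the same expectation with $r$ replaced by the constant vector $0$, and let $$\langle f,g\rangle_*=\langle f,g\rangle_{\mathcal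 A}-2\langle f,g\rangle_{\mathcal A_0}.$$ Let $S$ be the complex linear span of the functions $\mathbf p_\alpha\mathbf p_\beta$ with $\alpha,\beta\in\mathbb{N}^D$, $1\le|\alpha|,|\beta|\le N/2$. Then the expectations exist for all $f,g\in S$, and $\langle\cdot,\cdot\rangle_*$ is an inner product on $S$: it is linear in the first argument, conjugate-symmetric and positive definite. Moreover, the products $\mathbf p_{\{\alpha,\beta\}}=\mathbf p_\alpha\mathbf p_\beta$, indexed by the unordered pairs $\{\alpha,\beta\}$ with $1\le|\alpha|,|\beta|\le N/2$, form a basis of $S$ in which $\langle\cdot,\cdot\rangle_*$ is diagonal: $$\langle \mathbf p_\alpha\mathbf p_\beta,\mathbf p_\gamma\mathbf p_\delta\rangle_*=\begin{cases}0&\{\alpha,\beta\}\ne\{\gamma,\delta\},\\2&\{\alpha,\beta\}=\{\gamma,\delta\},\ |\alpha|\ne|\beta|,\\4&\{\alpha,\beta\}=\{\gamma,\delta\},\ |\alpha|=|\beta|,\ \alpha\ne\beta,\\8&\{\alpha,\beta\}=\{\gamma,\delta\},\ \alpha=\beta.\end{cases}$$ -/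

import Mathlib

noncomputable section

open MeasureTheory
open scoped ComplexConjugate

namespace MultisymHall

/-- The total degree `|α| = ∑ d, α d` of a multi-index. -/
def deg {D : ℕ} (α : Fin D → ℕ) : ℕ := ∑ d, α d

open Classical in
/-- The normalized multisymmetric power sum
`p_α(X) = |α|^(-1/2) * ∑ n, ∏ d, x_{dn} ^ α_d` on `D × M` complex matrices, with `p_0 = 1`. -/
def psum {D M : ℕ} (α : Fin D → ℕ) (X : Matrix (Fin D) (Fin M) ℂ) : ℂ :=
  if α = 0 then 1 else ((1 / Real.sqrt (deg α) : ℝ) : ℂ) * ∑ n, ∏ d, X d n ^ α d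

/-- The multi-indices `α ∈ ℕ^D` with `1 ≤ |α| ≤ N / 2`. -/
abbrev LowIdx (N D : ℕ) : Type := {α : Fin D → ℕ // 1 ≤ deg α ∧ (deg α : ℝ) ≤ (N : ℝ) / 2}

/-- The product `p_{α, β} = p_α p_β`, a function on `D × 2N` complex matrices,
indexed by the unordered pair `{α, β}`. -/
def psumPair (N D : ℕ) (s : Sym2 (LowIdx N D)) : Matrix (Fin D) (Fin (N + N)) ℂ → ℂ :=
  Sym2.lift ⟨fun α β X => psum α.1 X * psum β.1 X, fun α β => by
    funext X; exact mul_comm _ _⟩ s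

/-- The complex span of the products `p_α p_β` with `1 ≤ |α|, |β| ≤ N / 2`. -/
def pairSpan (N D : ℕ) : Submodule ℂ (Matrix (Fin D) (Fin (N + N)) ℂ → ℂ) :=
  Submodule.span ℂ {f | ∃ α β : LowIdx N D, f = fun X => psum α.1 X * psum β.1 X}

/-- The uniform probability measure on the unit circle of `ℂ`. -/
def circleLaw : Measure ℂ :=
  (ENNReal.ofReal (1 / (2 * Real.pi)) •
    (volume : Measure ℝ).restrict (Set.Icc 0 (2 * Real.pi))).map
      fun θ : ℝ => Complex.exp (θ * Complex.I)

/-- The law of a random vector with `n` i.i.d. entries, uniform on the unit circle. -/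
def torusLaw (n : ℕ) : Measure (Fin n → ℂ) := Measure.pi fun _ => circleLaw

/-- The Vandermonde determinant `∏_{i < j} (z_j - z_i)`. -/
def vdm {N : ℕ} (z : Fin N → ℂ) : ℂ := ∏ i, ∏ j ∈ Finset.Ioi i, (z j - z i)

/-- The law on the `N`-torus with density `|vdm|² / N!` with respect to the uniform law. It is the
joint law of the eigenvalues of a Haar-distributed unitary `N × N` matrix. -/
def vdmLaw (N : ℕ) : Measure (Fin N → ℂ) :=
  (torusLaw N).withDensity fun z => ENNReal.ofReal (‖vdm z‖ ^ 2 / N.factorial)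

/-- The `D × 2N` matrix with entries `q_d y_n` in the first `N` columns and `r_d y_n` in the
last `N` columns. -/
def inputMatrix {N D : ℕ} (y : Fin N → ℂ) (q r : Fin D → ℂ) :
    Matrix (Fin D) (Fin (N + N)) ℂ :=
  Matrix.of fun d => Fin.append (fun n => q d * y n) (fun n => r d * y n)

/-- The joint law of independent `(y, q, r)`, where `y` has law `vdmLaw N`, `q` is uniform on the
`D`-torus, and `r` has law `ρ`. -/
def jointLaw (N D : ℕ) (ρ : Measure (Fin D → ℂ)) :
    Measure ((Fin N → ℂ) × (Fin D → ℂ) × (Fin D → ℂ)) :=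
  (vdmLaw N).prod ((torusLaw D).prod ρ)

/-- The integrand `f(X) * conj (g(X))` as a function of `(y, q, r)`. -/
def integrand {N D : ℕ} (f g : Matrix (Fin D) (Fin (N + N)) ℂ → ℂ)
    (ω : (Fin N → ℂ) × (Fin D → ℂ) × (Fin D → ℂ)) : ℂ :=
  f (inputMatrix ω.1 ω.2.1 ω.2.2) * conj (g (inputMatrix ω.1 ω.2.1 ω.2.2))

/-- `⟨f, g⟩_A = E[f(X) conj (g(X))]` with `q` and `r` both uniform on the `D`-torus. -/
def formA {N D : ℕ} (f g : Matrix (Fin D) (Fin (N + N)) ℂ → ℂ) : ℂ :=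
  ∫ ω, integrand f g ω ∂(jointLaw N D (torusLaw D))

/-- `⟨f, g⟩_{A0} = E[f(X) conj (g(X))]` with `q` uniform on the `D`-torus and `r = 0`. -/
def formA0 {N D : ℕ} (f g : Matrix (Fin D) (Fin (N + N)) ℂ → ℂ) : ℂ :=
  ∫ ω, integrand f g ω ∂(jointLaw N D (Measure.dirac 0))

/-- `⟨f, g⟩_* = ⟨f, g⟩_A - 2 ⟨f, g⟩_{A0}`. -/
def formStar {N D : ℕ} (f g : Matrix (Fin D) (Fin (N + N)) ℂ → ℂ) : ℂ :=
  formA f g - 2 * formA0 f g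

end MultisymHall

end

open MeasureTheory
open scoped ComplexConjugate

namespace MultisymHall

/-! On the input matrix, `p_α` is `|α|^(-1/2) (q^α + r^α) P_{|α|}(y)` with `P_k = ∑ y_n^k`
(`psum_inputMatrix`), so each expectation is a row integral over `(q, r)` times a moment over `y`.
Row part: orthonormality of monomials on the torus gives `2[α+β=γ+δ] + 2([α=γ, β=δ] + [α=δ, β=γ])`,
while `r = 0` gives `[α+β=γ+δ]`. Subtracting twice the latter removes exactly the unwanted term
(`formStar_psumPair`), so distinct pairs are orthogonal whatever the `y`-moment is. Eigenvalue part: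
on the diagonal one needs `E|P_a P_b|² = ab(1 + [a=b])` for `a + b ≤ N` (`integral_powerSum`). With
`V` the Vandermonde determinant, an alternant, `P_k` acts on alternants by adding `k` to one
exponent at a time, with adjoint `P_{-k}`. Commuting `P_{-a}` past `P_a` and then past `P_b` leaves
few terms, since alternants with a repeated exponent vanish and negative exponents do not pair with
`P_b V`. The diagonal is therefore positive, which gives independence and definiteness. -/

/-! ### Laurent monomials on the torus. -/

instance : IsProbabilityMeasure circleLaw := by
  have hm : Measurable fun θ : ℝ => Complex.exp (θ * Complex.I) := by fun_prop
  constructor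
  rw [circleLaw, Measure.map_apply hm MeasurableSet.univ]
  simp only [Set.preimage_univ, Measure.smul_apply, Measure.restrict_apply_univ, Real.volume_Icc,
    smul_eq_mul, sub_zero]
  rw [← ENNReal.ofReal_mul (by positivity), one_div_mul_cancel (by positivity)]
  simp

instance (n : ℕ) : IsProbabilityMeasure (torusLaw n) := by
  unfold torusLaw; infer_instance

theorem ae_circleLaw_norm : ∀ᵐ z ∂circleLaw, ‖z‖ = 1 := by
  have hm : Measurable fun θ : ℝ => Complex.exp (θ * Complex.I) := by fun_prop
  rw [circleLaw, ae_map_iff hm.aemeasurable (measurableSet_eq_fun (by fun_prop) (by fun_prop))]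
  exact Filter.Eventually.of_forall fun θ => Complex.norm_exp_ofReal_mul_I θ

theorem ae_torusLaw_norm (n : ℕ) : ∀ᵐ z ∂torusLaw n, ∀ i, ‖z i‖ = 1 := by
  rw [ae_all_iff]
  intro i
  exact (Measure.quasiMeasurePreserving_eval (μ := fun _ : Fin n => circleLaw) i).ae
    ae_circleLaw_norm

theorem integral_zpow_circleLaw (m : ℤ) :
    ∫ z, z ^ m ∂circleLaw = if m = 0 then 1 else 0 := by
  split_ifs with h
  · simp [h]
  have hm : Measurable fun θ : ℝ => Complex.exp (θ * Complex.I) := by fun_prop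
  rw [circleLaw, integral_map hm.aemeasurable (by fun_prop), integral_smul_measure,
    integral_Icc_eq_integral_Ioc, ← intervalIntegral.integral_of_le (by positivity)]
  have hc : (m : ℂ) * Complex.I ≠ 0 := mul_ne_zero (by exact_mod_cast h) Complex.I_ne_zero
  have he : ∀ θ : ℝ, Complex.exp (θ * Complex.I) ^ m = Complex.exp (m * Complex.I * θ) := by
    intro θ
    rw [← Complex.exp_int_mul]
    ring_nf
  simp_rw [he]
  rw [integral_exp_mul_complex hc]
  have h2 : (m : ℂ) * Complex.I * ((2 * Real.pi : ℝ) : ℂ) = m * (2 * Real.pi * Complex.I) := by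
    push_cast; ring
  rw [h2, Complex.exp_int_mul_two_pi_mul_I]
  simp

/-- The Laurent monomial `∏ z_i ^ m_i`. -/
noncomputable def laurentMonomial {n : ℕ} (m : Fin n → ℤ) (z : Fin n → ℂ) : ℂ := ∏ i, z i ^ m i

theorem integral_laurentMonomial {n : ℕ} (m : Fin n → ℤ) :
    ∫ z, laurentMonomial m z ∂torusLaw n = if m = 0 then 1 else 0 := by
  unfold laurentMonomial torusLaw
  rw [integral_fintype_prod_eq_prod (fun i (z : ℂ) => z ^ m i)]
  simp_rw [integral_zpow_circleLaw]
  rw [Finset.prod_ite_zero]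
  simp [funext_iff]

theorem measurable_laurentMonomial {n : ℕ} (m : Fin n → ℤ) : Measurable (laurentMonomial m) := by
  unfold laurentMonomial
  fun_prop

theorem integrable_laurentMonomial {n : ℕ} (m : Fin n → ℤ) :
    Integrable (laurentMonomial m) (torusLaw n) := by
  refine Integrable.of_bound (measurable_laurentMonomial m).aestronglyMeasurable 1 ?_
  filter_upwards [ae_torusLaw_norm n] with z hz
  simp [laurentMonomial, hz]

theorem laurentMonomial_mul_conj {n : ℕ} (m k : Fin n → ℤ) {z : Fin n → ℂ}
    (hz : ∀ i, ‖z i‖ = 1) :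
    laurentMonomial m z * conj (laurentMonomial k z) = laurentMonomial (m - k) z := by
  unfold laurentMonomial
  rw [map_prod, ← Finset.prod_mul_distrib]
  refine Finset.prod_congr rfl fun i _ => ?_
  have h0 : z i ≠ 0 := by
    intro h; simpa [h] using hz i
  rw [map_zpow₀, ← Complex.inv_eq_conj (hz i), inv_zpow, Pi.sub_apply, zpow_sub₀ h0, div_eq_mul_inv]

theorem integrable_laurentMonomial_mul_conj {n : ℕ} (m k : Fin n → ℤ) :
    Integrable (fun z => laurentMonomial m z * conj (laurentMonomial k z)) (torusLaw n) := by
  refine (integrable_laurentMonomial (m - k)).congr ?_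
  filter_upwards [ae_torusLaw_norm n] with z hz
  exact (laurentMonomial_mul_conj m k hz).symm

theorem integral_laurentMonomial_mul_conj {n : ℕ} (m k : Fin n → ℤ) :
    ∫ z, laurentMonomial m z * conj (laurentMonomial k z) ∂torusLaw n = if m = k then 1 else 0 := by
  rw [integral_congr_ae (g := laurentMonomial (m - k)), integral_laurentMonomial]
  · simp [sub_eq_zero]
  · filter_upwards [ae_torusLaw_norm n] with z hz
    exact laurentMonomial_mul_conj m k hz

/-! ### Alternants and multiplication by power sums. -/

/-- The alternant `det (z_i ^ μ_j)`, expanded over permutations. -/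
noncomputable def alternant {N : ℕ} (μ : Fin N → ℤ) (z : Fin N → ℂ) : ℂ :=
  ∑ σ : Equiv.Perm (Fin N), ((Equiv.Perm.sign σ : ℤ) : ℂ) * laurentMonomial (μ ∘ σ) z

/-- The power sum `∑ z_i ^ k` with an integer exponent. -/
noncomputable def powerSum {N : ℕ} (k : ℤ) (z : Fin N → ℂ) : ℂ := ∑ i, z i ^ k

/-- The exponents `0, 1, …, N - 1` of the Vandermonde determinant. -/
noncomputable def staircase (N : ℕ) : Fin N → ℤ := fun i => (i : ℕ)

theorem alternant_eq_det {N : ℕ} (μ : Fin N → ℤ) (z : Fin N → ℂ) :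
    alternant μ z = (Matrix.of fun i j => z j ^ μ i).det := by
  rw [Matrix.det_apply']
  rfl

theorem alternant_staircase {N : ℕ} (z : Fin N → ℂ) : alternant (staircase N) z = vdm z := by
  rw [alternant_eq_det, ← Matrix.det_transpose, vdm, ← Matrix.det_vandermonde]
  congr 1

theorem alternant_of_not_injective {N : ℕ} {μ : Fin N → ℤ} (h : ¬ Function.Injective μ)
    (z : Fin N → ℂ) : alternant μ z = 0 := by
  obtain ⟨i, j, hij, hne⟩ : ∃ i j, μ i = μ j ∧ i ≠ j := by
    simpa [Function.Injective] using h
  rw [alternant_eq_det]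
  exact Matrix.det_zero_of_row_eq hne (by ext; simp [hij])

theorem powerSum_mul_alternant {N : ℕ} (k : ℤ) (μ : Fin N → ℤ) {z : Fin N → ℂ}
    (hz : ∀ i, ‖z i‖ = 1) :
    powerSum k z * alternant μ z = ∑ i, alternant (μ + Pi.single i k) z := by
  have h0 : ∀ i, z i ≠ 0 := fun i h => by simpa [h] using hz i
  unfold alternant
  rw [Finset.sum_comm, Finset.mul_sum]
  refine Finset.sum_congr rfl fun σ _ => ?_
  rw [← Finset.mul_sum, mul_left_comm]
  congr 1
  -- Reindexing the shifted position by `σ` matches terms: adding `k` to `μ` at `σ i` multiplies the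
  -- monomial of `μ ∘ σ` by `z i ^ k`.
  rw [powerSum, Finset.sum_mul,
    ← Equiv.sum_comp σ fun i => laurentMonomial ((μ + (Pi.single i k : Fin N → ℤ)) ∘ σ) z]
  refine Finset.sum_congr rfl fun i _ => ?_
  unfold laurentMonomial
  have : ∀ n, z n ^ ((μ + Pi.single (σ i) k) ∘ σ) n
      = z n ^ (μ ∘ σ) n * (if n = i then z i ^ k else 1) := by
    intro n
    by_cases h : n = i
    · subst h; simp [zpow_add₀ (h0 n)]
    · simp [h]
  simp_rw [this, Finset.prod_mul_distrib]
  simp [mul_comm]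

theorem conj_powerSum {N : ℕ} (k : ℤ) {z : Fin N → ℂ} (hz : ∀ i, ‖z i‖ = 1) :
    conj (powerSum k z) = powerSum (-k) z := by
  simp only [powerSum, map_sum, map_zpow₀]
  refine Finset.sum_congr rfl fun i _ => ?_
  rw [← Complex.inv_eq_conj (hz i), inv_zpow, zpow_neg]

/-! ### Inner products of alternants. -/

/-- The inner product of two alternants on the torus. -/
noncomputable def gram {N : ℕ} (μ ν : Fin N → ℤ) : ℂ := ∫ z, alternant μ z * conj (alternant ν z) ∂torusLaw N

theorem alternant_mul_conj {N : ℕ} (μ ν : Fin N → ℤ) (z : Fin N → ℂ) :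
    alternant μ z * conj (alternant ν z) = ∑ σ : Equiv.Perm (Fin N), ∑ τ : Equiv.Perm (Fin N),
      ((Equiv.Perm.sign σ : ℤ) : ℂ) * ((Equiv.Perm.sign τ : ℤ) : ℂ) *
        (laurentMonomial (μ ∘ σ) z * conj (laurentMonomial (ν ∘ τ) z)) := by
  simp only [alternant, map_sum, map_mul, Finset.sum_mul_sum]
  refine Finset.sum_congr rfl fun σ _ => Finset.sum_congr rfl fun τ _ => ?_
  simp only [map_intCast]
  ring

theorem integrable_alternant_mul_conj {N : ℕ} (μ ν : Fin N → ℤ) :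
    Integrable (fun z => alternant μ z * conj (alternant ν z)) (torusLaw N) := by
  simp_rw [alternant_mul_conj]
  exact integrable_finsetSum _ fun σ _ => integrable_finsetSum _ fun τ _ =>
    (integrable_laurentMonomial_mul_conj _ _).const_mul _

theorem gram_eq_sum {N : ℕ} (μ ν : Fin N → ℤ) :
    gram μ ν = ∑ σ : Equiv.Perm (Fin N), ∑ τ : Equiv.Perm (Fin N),
      ((Equiv.Perm.sign σ : ℤ) : ℂ) * ((Equiv.Perm.sign τ : ℤ) : ℂ) *
        if μ ∘ σ = ν ∘ τ then 1 else 0 := by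
  unfold gram
  simp_rw [alternant_mul_conj]
  rw [integral_finsetSum _ fun σ _ => integrable_finsetSum _ fun τ _ =>
    (integrable_laurentMonomial_mul_conj _ _).const_mul _]
  refine Finset.sum_congr rfl fun σ _ => ?_
  rw [integral_finsetSum _ fun τ _ => (integrable_laurentMonomial_mul_conj _ _).const_mul _]
  refine Finset.sum_congr rfl fun τ _ => ?_
  rw [integral_const_mul, integral_laurentMonomial_mul_conj]

/-- Monomials of the two alternants can agree only if `μ` and `ν` are rearrangements of each other.
-/
theorem gram_eq_zero_of_notMem {N : ℕ} {μ ν : Fin N → ℤ} (l : Fin N) (h : ∀ k, μ l ≠ ν k) :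
    gram μ ν = 0 := by
  rw [gram_eq_sum]
  refine Finset.sum_eq_zero fun σ _ => Finset.sum_eq_zero fun τ _ => ?_
  rw [if_neg, mul_zero]
  intro he
  exact h (τ (σ.symm l)) (by simpa using congrFun he (σ.symm l))

theorem gram_of_not_injective {N : ℕ} {μ : Fin N → ℤ} (h : ¬ Function.Injective μ)
    (ν : Fin N → ℤ) : gram μ ν = 0 := by
  simp [gram, alternant_of_not_injective h]

theorem staircase_injective (N : ℕ) : Function.Injective (staircase N) := fun i j h => by
  simpa [staircase, Fin.val_inj] using h

theorem gram_staircase (N : ℕ) : gram (staircase N) (staircase N) = N.factorial := by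
  rw [gram_eq_sum]
  have : ∀ σ τ : Equiv.Perm (Fin N),
      ((Equiv.Perm.sign σ : ℤ) : ℂ) * ((Equiv.Perm.sign τ : ℤ) : ℂ) *
        (if staircase N ∘ σ = staircase N ∘ τ then 1 else 0) = if σ = τ then 1 else 0 := by
    intro σ τ
    have : staircase N ∘ σ = staircase N ∘ τ ↔ σ = τ := by
      rw [(staircase_injective N).comp_left.eq_iff]
      exact DFunLike.coe_fn_eq
    by_cases h : σ = τ
    · subst h
      rw [if_pos rfl, if_pos rfl, mul_one]
      norm_cast
      simp
    · rw [if_neg (this.not.mpr h), if_neg h, mul_zero]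
  simp_rw [this]
  simp [Fintype.card_perm]

/-! ### Raising and lowering exponents; second moments. -/

/-- Multiplication by `powerSum k` and by `powerSum (-k)` are adjoint. -/
theorem sum_gram_add_single {N : ℕ} (k : ℤ) (μ ν : Fin N → ℤ) :
    ∑ i, gram (μ + Pi.single i k) ν = ∑ i, gram μ (ν + Pi.single i (-k)) := by
  unfold gram
  rw [← integral_finsetSum _ fun i _ => integrable_alternant_mul_conj _ _,
    ← integral_finsetSum _ fun i _ => integrable_alternant_mul_conj _ _]
  refine integral_congr_ae ?_
  filter_upwards [ae_torusLaw_norm N] with z hz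
  rw [← Finset.sum_mul, ← powerSum_mul_alternant k μ hz, ← Finset.mul_sum, ← map_sum,
    ← powerSum_mul_alternant (-k) ν hz, map_mul, conj_powerSum (-k) hz, neg_neg]
  ring

/-- The commutator of the truncated raising and lowering operators. -/
theorem sum_raise_lower {N : ℕ} (Λ : (Fin N → ℤ) → ℂ) (hΛ : ∀ μ l, μ l < 0 → Λ μ = 0)
    (a : ℤ) (μ : Fin N → ℤ) :
    ∑ l, ∑ i, Λ (μ + Pi.single i a + Pi.single l (-a)) =
      (Finset.univ.filter fun l => μ l < a).card * Λ μ +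
      ∑ l with a ≤ μ l, ∑ i, Λ (μ + Pi.single l (-a) + Pi.single i a) := by
  -- If `μ l < a`, lowering at `l` leaves a negative exponent unless the raise is also at `l`, where
  -- the shifts cancel. Otherwise the shifts are merely swapped.
  have h1 : ∀ l, ∑ i, Λ (μ + Pi.single i a + Pi.single l (-a)) =
      (if μ l < a then Λ μ else 0) +
      if a ≤ μ l then ∑ i, Λ (μ + Pi.single l (-a) + Pi.single i a) else 0 := by
    intro l
    by_cases h : μ l < a
    · rw [if_pos h, if_neg (not_le.mpr h), add_zero, Finset.sum_eq_single l]
      · congr 1; rw [add_assoc, ← Pi.single_add]; simp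
      · intro i _ hi
        refine hΛ _ l ?_
        simp [hi.symm, h]
      · simp
    · rw [if_neg h, if_pos (not_lt.mp h), zero_add]
      exact Finset.sum_congr rfl fun i _ => by rw [add_right_comm]
  simp_rw [h1, Finset.sum_add_distrib]
  rw [← Finset.sum_filter, ← Finset.sum_filter, Finset.sum_const, nsmul_eq_mul]

theorem staircase_not_injective {N : ℕ} {i k : Fin N} {c : ℤ} (hik : i ≠ k)
    (h : (k : ℤ) = i + c) : ¬ Function.Injective (staircase N + Pi.single i c) := by
  intro hi
  refine hik (hi ?_)
  simp [staircase, hik.symm, h]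

/-- A lowered exponent that stays nonnegative collides with the entry at `l - a`; hence truncated
lowering annihilates the Vandermonde determinant. -/
theorem staircase_lower_not_injective {N : ℕ} {l : Fin N} {a : ℕ} (ha : 1 ≤ a)
    (hl : (a : ℤ) ≤ staircase N l) :
    ¬ Function.Injective (staircase N + Pi.single l (-a : ℤ)) := by
  have hl' : a ≤ (l : ℕ) := by simpa [staircase] using hl
  refine staircase_not_injective (k := ⟨l - a, by omega⟩) ?_ ?_
  · intro h
    have := congrArg Fin.val h
    simp at this; omega
  · simp; omega

theorem card_staircase_lt {N a : ℕ} (ha : a ≤ N) :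
    (Finset.univ.filter fun l => staircase N l < a).card = a := by
  simp only [staircase, Nat.cast_lt]
  have := Fin.card_filter_val_lt (n := N) (m := a)
  simpa [ha] using this

/-- Positive-degree second moments: `∫ |P_b|² |vdm|² = b N!`. -/
theorem sum_gram_raise {N b : ℕ} (hb : 1 ≤ b) (hbN : b ≤ N) :
    ∑ j, ∑ k, gram (staircase N + Pi.single j (b : ℤ)) (staircase N + Pi.single k (b : ℤ)) =
      b * N.factorial := by
  have h1 : ∀ j, ∑ k, gram (staircase N + Pi.single j (b : ℤ)) (staircase N + Pi.single k (b : ℤ))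
      = ∑ k, gram (staircase N + Pi.single j (b : ℤ) + Pi.single k (-b : ℤ)) (staircase N) := by
    intro j
    rw [sum_gram_add_single, neg_neg]
  simp_rw [h1]
  rw [Finset.sum_comm, sum_raise_lower (fun μ => gram μ (staircase N)), card_staircase_lt hbN,
    gram_staircase, Finset.sum_eq_zero, add_zero]
  · intro l hl
    rw [sum_gram_add_single]
    exact Finset.sum_eq_zero fun i _ => gram_of_not_injective
      (staircase_lower_not_injective hb (Finset.mem_filter.mp hl).2) _
  · intro μ l hl
    refine gram_eq_zero_of_notMem l fun k => ?_
    simp only [staircase]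
    omega

/-! ### Fourth moments: combinatorics of exponents. -/

/-- The Gram pairing of an alternant with `P_b` times the Vandermonde determinant. -/
noncomputable def raisePairing (N b : ℕ) (μ : Fin N → ℤ) : ℂ :=
  ∑ k, gram μ (staircase N + Pi.single k (b : ℤ))

theorem raisePairing_of_neg {N b : ℕ} (μ : Fin N → ℤ) (l : Fin N) (h : μ l < 0) :
    raisePairing N b μ = 0 := by
  refine Finset.sum_eq_zero fun k _ => gram_eq_zero_of_notMem l fun k' => ?_
  have : (0 : ℤ) ≤ (staircase N + Pi.single k (b : ℤ) : Fin N → ℤ) k' := by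
    have : (0 : ℤ) ≤ (Pi.single k (b : ℤ) : Fin N → ℤ) k' := by
      rw [Pi.single_apply]; split_ifs <;> positivity
    simp only [Pi.add_apply, staircase]
    positivity
  omega

theorem raisePairing_of_not_injective {N b : ℕ} {μ : Fin N → ℤ} (h : ¬ Function.Injective μ) :
    raisePairing N b μ = 0 :=
  Finset.sum_eq_zero fun _ _ => gram_of_not_injective h _

/-- The shifted exponents may be distinct, so single terms need not vanish; moving the shift to the
other side by adjointness restores the zero alternant of `μ`. -/
theorem sum_raisePairing_of_not_injective {N b : ℕ} {μ : Fin N → ℤ} (c : ℤ)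
    (h : ¬ Function.Injective μ) : ∑ i, raisePairing N b (μ + Pi.single i c) = 0 := by
  unfold raisePairing
  rw [Finset.sum_comm]
  refine Finset.sum_eq_zero fun k _ => ?_
  rw [sum_gram_add_single]
  exact Finset.sum_eq_zero fun _ _ => gram_of_not_injective h _

theorem sum_sum_raisePairing_of_not_injective {N b : ℕ} {μ : Fin N → ℤ} (c d : ℤ)
    (h : ¬ Function.Injective μ) :
    ∑ j, ∑ i, raisePairing N b (μ + Pi.single j c + Pi.single i d) = 0 := by
  unfold raisePairing
  have h1 : ∀ j, ∑ i, ∑ k, gram (μ + Pi.single j c + Pi.single i d)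
      (staircase N + Pi.single k (b : ℤ)) = ∑ k, ∑ i, gram (μ + Pi.single j c)
      (staircase N + Pi.single k (b : ℤ) + Pi.single i (-d)) := by
    intro j
    rw [Finset.sum_comm]
    exact Finset.sum_congr rfl fun k _ => sum_gram_add_single _ _ _
  simp_rw [h1]
  rw [Finset.sum_comm]
  refine Finset.sum_eq_zero fun k _ => ?_
  rw [Finset.sum_comm]
  refine Finset.sum_eq_zero fun i _ => ?_
  rw [sum_gram_add_single]
  exact Finset.sum_eq_zero fun _ _ => gram_of_not_injective h _

/-- The lowering part of the fourth moment: `P_{-a}`, truncated, applied to `P_b` times the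
Vandermonde determinant. -/
theorem sum_lower_raise {N a b : ℕ} (ha : 1 ≤ a) (hab : a ≤ b) (hN : a + b ≤ N)
    (M : (Fin N → ℤ) → ℂ) (hM : ∀ μ, ¬ Function.Injective μ → M μ = 0)
    (hM' : ∀ μ, ¬ Function.Injective μ → ∑ j, M (μ + Pi.single j (b : ℤ)) = 0) :
    ∑ j, ∑ l with (a : ℤ) ≤ (staircase N + Pi.single j (b : ℤ) : Fin N → ℤ) l,
      M (staircase N + Pi.single j (b : ℤ) + Pi.single l (-a : ℤ)) =
    if a = b then a * M (staircase N) else 0 := by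
  -- Truncating after or before the raise differs only at `l = j`, where a raise by `b ≥ a` always
  -- permits lowering.
  have h1 : ∀ j l : Fin N, (if (a : ℤ) ≤ (staircase N + Pi.single j (b : ℤ) : Fin N → ℤ) l then
      M (staircase N + Pi.single j (b : ℤ) + Pi.single l (-a : ℤ)) else 0) =
      (if (a : ℤ) ≤ staircase N l then
        M (staircase N + Pi.single l (-a : ℤ) + Pi.single j (b : ℤ)) else 0) +
      if l = j then (if staircase N l < a then
        M (staircase N + Pi.single l (b - a : ℤ)) else 0) else 0 := by
    intro j l
    rw [add_right_comm (staircase N) (Pi.single l (-a : ℤ))]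
    by_cases h : l = j
    · subst h
      rw [if_pos rfl, add_assoc (staircase N), ← Pi.single_add, ← sub_eq_add_neg, if_pos]
      · by_cases h2 : staircase N l < a
        · rw [if_neg (not_le.mpr h2), if_pos h2, zero_add]
        · rw [if_pos (not_lt.mp h2), if_neg h2, add_zero]
      · simp [staircase]; omega
    · simp [h]
  simp_rw [Finset.sum_filter, h1, Finset.sum_add_distrib]
  rw [Finset.sum_comm, Finset.sum_eq_zero, zero_add]
  · simp only [Finset.sum_ite_eq', Finset.mem_univ, if_true]
    split_ifs with h
    · subst h
      simp only [sub_self, Pi.single_zero, add_zero]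
      rw [← Finset.sum_filter, Finset.sum_const, card_staircase_lt (by omega), nsmul_eq_mul]
    · refine Finset.sum_eq_zero fun j _ => ?_
      split_ifs with hj
      · have hj' : (j : ℕ) < a := by simpa [staircase] using hj
        -- For `a < b`, the exponent `j + (b - a) < b ≤ N` is already on the staircase.
        refine hM _ (staircase_not_injective (k := ⟨j + (b - a), by omega⟩) ?_ ?_)
        · intro he
          have := congrArg Fin.val he
          simp at this; omega
        · simp; omega
      · rfl
  · intro l _
    by_cases h : (a : ℤ) ≤ staircase N l
    · simp only [h, if_true]
      exact hM' _ (staircase_lower_not_injective ha h)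
    · simp [h]

theorem sum_gram_raise_raise {N a b : ℕ} (ha : 1 ≤ a) (hab : a ≤ b) (hN : a + b ≤ N) :
    ∑ j, ∑ l, ∑ i, raisePairing N b
      (staircase N + Pi.single j (b : ℤ) + Pi.single i (a : ℤ) + Pi.single l (-a : ℤ)) =
      (a * b + if a = b then a * b else 0) * N.factorial := by
  have hb : ∑ j, raisePairing N b (staircase N + Pi.single j (b : ℤ)) = b * N.factorial :=
    sum_gram_raise (by omega) (by omega)
  simp_rw [sum_raise_lower (raisePairing N b) raisePairing_of_neg]
  -- `M μ` pairs `P_a` times the alternant of `μ` with `P_b V`.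
  obtain ⟨M, hM⟩ : ∃ M : (Fin N → ℤ) → ℂ,
      ∀ μ, ∑ i, raisePairing N b (μ + Pi.single i (a : ℤ)) = M μ := ⟨_, fun _ => rfl⟩
  have h0 := sum_lower_raise ha hab hN M
    (fun μ h => by rw [← hM]; exact sum_raisePairing_of_not_injective _ h)
    (fun μ h => by simp_rw [← hM]; exact sum_sum_raisePairing_of_not_injective _ _ h)
  simp_rw [hM]
  rw [Finset.sum_add_distrib, h0]
  -- If `j < a`, then `j + b < N` by `a + b ≤ N`, so the raised exponent is repeated and the pairing
  -- is zero. If `j ≥ a`, the raise leaves the `a` exponents below `a` untouched.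
  have h1 : ∀ j : Fin N, ((Finset.univ.filter fun l =>
      (staircase N + Pi.single j (b : ℤ) : Fin N → ℤ) l < a).card : ℂ) *
      raisePairing N b (staircase N + Pi.single j (b : ℤ)) =
      a * raisePairing N b (staircase N + Pi.single j (b : ℤ)) := by
    intro j
    by_cases hj : (j : ℕ) < a
    · rw [raisePairing_of_not_injective, mul_zero, mul_zero]
      refine staircase_not_injective (k := ⟨j + b, by omega⟩) ?_ (by simp)
      intro h
      have := congrArg Fin.val h
      simp at this; omega
    · congr 2
      refine (congrArg Finset.card ?_).trans (card_staircase_lt (N := N) (by omega))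
      ext l
      simp only [Finset.mem_filter, Finset.mem_univ, true_and]
      by_cases h : l = j
      · subst h
        simp [staircase]; omega
      · simp [h]
  simp_rw [h1]
  rw [← Finset.mul_sum, hb]
  split_ifs with h
  · subst h
    rw [← hM, hb]; push_cast; ring
  · ring

/-! ### Integrability, and fourth moments under the eigenvalue law. -/

/-- All the laws involved live in the closed unit ball of a sup norm, which is compact. -/
theorem integrable_of_continuous_of_norm_le_one {E : Type*} [NormedAddCommGroup E] [ProperSpace E]
    [MeasurableSpace E] [OpensMeasurableSpace E] {ν : Measure E} [IsFiniteMeasure ν]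
    (hν : ∀ᵐ x ∂ν, ‖x‖ ≤ 1) {f : E → ℂ} (hf : Continuous f) : Integrable f ν := by
  obtain ⟨C, hC⟩ := (isCompact_closedBall (0 : E) 1).exists_bound_of_continuousOn hf.continuousOn
  refine Integrable.of_bound hf.aestronglyMeasurable C ?_
  filter_upwards [hν] with x hx
  exact hC x (by simpa using hx)

theorem ae_torusLaw_norm_le (n : ℕ) : ∀ᵐ z ∂torusLaw n, ‖z‖ ≤ 1 := by
  filter_upwards [ae_torusLaw_norm n] with z hz
  exact (pi_norm_le_iff_of_nonneg zero_le_one).mpr fun i => (hz i).le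

theorem continuous_vdm {N : ℕ} : Continuous (vdm (N := N)) := by
  unfold vdm; fun_prop

instance (N : ℕ) : IsFiniteMeasure (vdmLaw N) := by
  unfold vdmLaw
  refine isFiniteMeasure_withDensity_ofReal ?_
  exact (integrable_of_continuous_of_norm_le_one (ae_torusLaw_norm_le N)
    (Complex.continuous_ofReal.comp
      ((continuous_vdm.norm.pow 2).div_const (N.factorial : ℝ)))).re.hasFiniteIntegral

theorem ae_vdmLaw_norm_le (N : ℕ) : ∀ᵐ z ∂vdmLaw N, ‖z‖ ≤ 1 :=
  (withDensity_absolutelyContinuous _ _).ae_le (ae_torusLaw_norm_le N)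

instance (N D : ℕ) (ρ : Measure (Fin D → ℂ)) [IsFiniteMeasure ρ] :
    IsFiniteMeasure (jointLaw N D ρ) := by
  unfold jointLaw; infer_instance

theorem ae_jointLaw_norm_le (N D : ℕ) (ρ : Measure (Fin D → ℂ)) [IsFiniteMeasure ρ]
    (hρ : ∀ᵐ r ∂ρ, ‖r‖ ≤ 1) : ∀ᵐ ω ∂jointLaw N D ρ, ‖ω‖ ≤ 1 := by
  unfold jointLaw
  have h1 := (Measure.quasiMeasurePreserving_fst (μ := vdmLaw N)
    (ν := (torusLaw D).prod ρ)).ae (ae_vdmLaw_norm_le N)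
  have h2 := (Measure.quasiMeasurePreserving_snd (μ := vdmLaw N)
    (ν := (torusLaw D).prod ρ)).ae ((Measure.quasiMeasurePreserving_fst (μ := torusLaw D)
    (ν := ρ)).ae (ae_torusLaw_norm_le D))
  have h3 := (Measure.quasiMeasurePreserving_snd (μ := vdmLaw N)
    (ν := (torusLaw D).prod ρ)).ae ((Measure.quasiMeasurePreserving_snd (μ := torusLaw D)
    (ν := ρ)).ae hρ)
  filter_upwards [h1, h2, h3] with ω a b c
  exact norm_prod_le_iff.mpr ⟨a, norm_prod_le_iff.mpr ⟨b, c⟩⟩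

theorem integral_vdmLaw {N : ℕ} (F : (Fin N → ℂ) → ℂ) :
    ∫ y, F y ∂vdmLaw N =
      (N.factorial : ℂ)⁻¹ * ∫ y, F y * (vdm y * conj (vdm y)) ∂torusLaw N := by
  unfold vdmLaw
  rw [integral_withDensity_eq_integral_toReal_smul, ← integral_const_mul]
  · refine integral_congr_ae (Filter.Eventually.of_forall fun y => ?_)
    simp only
    rw [ENNReal.toReal_ofReal (by positivity), Complex.mul_conj, Complex.normSq_eq_norm_sq,
      Complex.real_smul]
    push_cast
    ring
  · exact (((continuous_vdm.norm.pow 2).div_const _).measurable).ennreal_ofReal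
  · exact Filter.Eventually.of_forall fun _ => ENNReal.ofReal_lt_top

theorem integral_powerSum_aux {N a b : ℕ} (ha : 1 ≤ a) (hab : a ≤ b) (hN : a + b ≤ N) :
    ∫ y, powerSum a y * powerSum b y * conj (powerSum a y * powerSum b y) ∂vdmLaw N =
      a * b + if a = b then a * b else 0 := by
  rw [integral_vdmLaw]
  -- On the torus `conj P_a = P_{-a}` is moved to the left factor, giving `P_{-a} P_a P_b V` against
  -- `P_b V`.
  have h1 : ∀ᵐ y ∂torusLaw N, powerSum a y * powerSum b y * conj (powerSum a y * powerSum b y) *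
      (vdm y * conj (vdm y)) = ∑ j, ∑ l, ∑ i, ∑ k,
      alternant (staircase N + Pi.single j (b : ℤ) + Pi.single i (a : ℤ) + Pi.single l (-a : ℤ)) y *
        conj (alternant (staircase N + Pi.single k (b : ℤ)) y) := by
    filter_upwards [ae_torusLaw_norm N] with y hy
    simp_rw [← Finset.mul_sum, ← map_sum, ← Finset.sum_mul, ← powerSum_mul_alternant _ _ hy]
    have h2 : ∀ j, ∑ l, ∑ i, alternant (staircase N + Pi.single j (b : ℤ) + Pi.single i (a : ℤ) +
        Pi.single l (-a : ℤ)) y = powerSum (-a) y * (powerSum a y *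
          alternant (staircase N + Pi.single j (b : ℤ)) y) := by
      intro j
      rw [Finset.sum_comm]
      simp_rw [← powerSum_mul_alternant _ _ hy, ← Finset.mul_sum, ← powerSum_mul_alternant _ _ hy]
    simp_rw [h2, ← Finset.mul_sum, ← powerSum_mul_alternant _ _ hy, alternant_staircase, map_mul,
      conj_powerSum _ hy]
    ring
  rw [integral_congr_ae h1]
  have hi : ∀ j l i k, Integrable (fun y =>
      alternant (staircase N + Pi.single j (b : ℤ) + Pi.single i (a : ℤ) + Pi.single l (-a : ℤ)) y *
        conj (alternant (staircase N + Pi.single k (b : ℤ)) y)) (torusLaw N) :=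
    fun j l i k => integrable_alternant_mul_conj _ _
  rw [integral_finsetSum _ fun j _ => integrable_finsetSum _ fun l _ => integrable_finsetSum _
    fun i _ => integrable_finsetSum _ fun k _ => hi j l i k]
  have h3 : ∀ j, ∫ y, ∑ l, ∑ i, ∑ k,
      alternant (staircase N + Pi.single j (b : ℤ) + Pi.single i (a : ℤ) + Pi.single l (-a : ℤ)) y *
        conj (alternant (staircase N + Pi.single k (b : ℤ)) y) ∂torusLaw N =
      ∑ l, ∑ i, raisePairing N b
        (staircase N + Pi.single j (b : ℤ) + Pi.single i (a : ℤ) + Pi.single l (-a : ℤ)) := by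
    intro j
    rw [integral_finsetSum _ fun l _ => integrable_finsetSum _
      fun i _ => integrable_finsetSum _ fun k _ => hi j l i k]
    refine Finset.sum_congr rfl fun l _ => ?_
    rw [integral_finsetSum _ fun i _ => integrable_finsetSum _ fun k _ => hi j l i k]
    refine Finset.sum_congr rfl fun i _ => ?_
    rw [integral_finsetSum _ fun k _ => hi j l i k]
    rfl
  simp_rw [h3]
  rw [sum_gram_raise_raise ha hab hN]
  have : (N.factorial : ℂ) ≠ 0 := by exact_mod_cast N.factorial_ne_zero
  field_simp

/-- Fourth moments of power sums of the eigenvalues of a Haar-distributed unitary matrix. -/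
theorem integral_powerSum {N a b : ℕ} (ha : 1 ≤ a) (hb : 1 ≤ b) (hN : a + b ≤ N) :
    ∫ y, powerSum a y * powerSum b y * conj (powerSum a y * powerSum b y) ∂vdmLaw N =
      a * b + if a = b then a * b else 0 := by
  rcases le_total a b with h | h
  · exact integral_powerSum_aux ha h hN
  · have := integral_powerSum_aux hb h (by omega : b + a ≤ N)
    simp_rw [mul_comm (powerSum b _), mul_comm (b : ℂ), mul_comm b, eq_comm (a := b)] at this
    exact this

/-! ### Integrals over the row variables. -/

/-- The monomial `∏ q_d ^ α_d` with natural exponents. -/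
noncomputable def rowMonomial {D : ℕ} (α : Fin D → ℕ) (q : Fin D → ℂ) : ℂ := ∏ d, q d ^ α d

theorem continuous_rowMonomial {D : ℕ} (α : Fin D → ℕ) : Continuous (rowMonomial α) := by
  unfold rowMonomial; fun_prop

theorem rowMonomial_add {D : ℕ} (α β : Fin D → ℕ) (q : Fin D → ℂ) :
    rowMonomial (α + β) q = rowMonomial α q * rowMonomial β q := by
  simp [rowMonomial, pow_add, Finset.prod_mul_distrib]

theorem rowMonomial_at_zero {D : ℕ} {α : Fin D → ℕ} (h : α ≠ 0) : rowMonomial α 0 = 0 := by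
  obtain ⟨d, hd⟩ := Function.ne_iff.mp h
  exact Finset.prod_eq_zero (Finset.mem_univ d) (by simpa using hd)

theorem integral_rowMonomial_mul_conj {D : ℕ} (α β : Fin D → ℕ) :
    ∫ q, rowMonomial α q * conj (rowMonomial β q) ∂torusLaw D = if α = β then 1 else 0 := by
  have := integral_laurentMonomial_mul_conj (fun d => (α d : ℤ)) (fun d => (β d : ℤ))
  simpa [laurentMonomial, rowMonomial, funext_iff] using this

theorem integral_rowMonomial_prod {D : ℕ} (α β γ δ : Fin D → ℕ) :
    ∫ p : (Fin D → ℂ) × (Fin D → ℂ), rowMonomial α p.1 * rowMonomial β p.2 *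
      conj (rowMonomial γ p.1 * rowMonomial δ p.2) ∂(torusLaw D).prod (torusLaw D) =
    if α = γ ∧ β = δ then 1 else 0 := by
  have h : ∀ p : (Fin D → ℂ) × (Fin D → ℂ), rowMonomial α p.1 * rowMonomial β p.2 *
      conj (rowMonomial γ p.1 * rowMonomial δ p.2) =
      (rowMonomial α p.1 * conj (rowMonomial γ p.1)) *
        (rowMonomial β p.2 * conj (rowMonomial δ p.2)) := fun p => by rw [map_mul]; ring
  simp_rw [h]
  rw [integral_prod_mul (fun q => rowMonomial α q * conj (rowMonomial γ q))
    (fun q => rowMonomial β q * conj (rowMonomial δ q)), integral_rowMonomial_mul_conj,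
    integral_rowMonomial_mul_conj, ite_and]
  split_ifs <;> simp

/-- The dependence of `p_α p_β` on the row variables. -/
noncomputable def rowFactor {D : ℕ} (α β : Fin D → ℕ) (p : (Fin D → ℂ) × (Fin D → ℂ)) : ℂ :=
  (rowMonomial α p.1 + rowMonomial α p.2) * (rowMonomial β p.1 + rowMonomial β p.2)

theorem integral_rowFactor {D : ℕ} {α β γ δ : Fin D → ℕ} (hα : α ≠ 0) (hβ : β ≠ 0) (hγ : γ ≠ 0)
    (hδ : δ ≠ 0) :
    ∫ p, rowFactor α β p * conj (rowFactor γ δ p) ∂(torusLaw D).prod (torusLaw D) =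
      2 * (if α + β = γ + δ then 1 else 0) + 2 * ((if α = γ ∧ β = δ then 1 else 0) +
        if α = δ ∧ β = γ then 1 else 0) := by
  -- The bidegrees in `(q, r)` of the four monomials of the expanded product.
  set e : Fin 4 → (Fin D → ℕ) × (Fin D → ℕ) := ![(α + β, 0), (0, α + β), (α, β), (β, α)] with he
  set e' : Fin 4 → (Fin D → ℕ) × (Fin D → ℕ) := ![(γ + δ, 0), (0, γ + δ), (γ, δ), (δ, γ)] with he'
  have h1 : ∀ p, rowFactor α β p * conj (rowFactor γ δ p) = ∑ i, ∑ j,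
      rowMonomial (e i).1 p.1 * rowMonomial (e i).2 p.2 *
      conj (rowMonomial (e' j).1 p.1 * rowMonomial (e' j).2 p.2) := by
    intro p
    have h0 : ∀ q : Fin D → ℂ, rowMonomial 0 q = 1 := fun q => by simp [rowMonomial]
    simp only [← Finset.mul_sum, ← Finset.sum_mul, ← map_sum]
    congr 1
    · simp [he, Fin.sum_univ_four, rowFactor, rowMonomial_add, h0]; ring
    · congr 1
      simp [he', Fin.sum_univ_four, rowFactor, rowMonomial_add, h0]; ring
  have hi : ∀ i j, Integrable (fun p : (Fin D → ℂ) × (Fin D → ℂ) =>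
      rowMonomial (e i).1 p.1 * rowMonomial (e i).2 p.2 *
      conj (rowMonomial (e' j).1 p.1 * rowMonomial (e' j).2 p.2))
      ((torusLaw D).prod (torusLaw D)) := by
    intro i j
    refine integrable_of_continuous_of_norm_le_one ?_ ?_
    · filter_upwards [Measure.quasiMeasurePreserving_fst.ae (ae_torusLaw_norm_le D),
        Measure.quasiMeasurePreserving_snd.ae (ae_torusLaw_norm_le D)] with p h1 h2
      exact norm_prod_le_iff.mpr ⟨h1, h2⟩
    · have := continuous_rowMonomial (D := D)
      fun_prop
  simp_rw [h1]
  rw [integral_finsetSum _ fun i _ => integrable_finsetSum _ fun j _ => hi i j]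
  simp_rw [integral_finsetSum _ fun j _ => hi _ j, integral_rowMonomial_prod]
  have n1 : α + β ≠ 0 := by simp [hα]
  have n2 : γ + δ ≠ 0 := by simp [hγ]
  simp only [Fin.sum_univ_four, he, he', Matrix.cons_val]
  -- Nonzero indices rule out any match between a monomial in one of `q`, `r` alone and a mixed one,
  -- or between the two pure ones.
  simp only [hα, hβ, hγ.symm, hδ.symm, n1, n2.symm, and_false, false_and, and_true, true_and,
    if_false, add_zero, zero_add, and_comm (a := β = γ), and_comm (a := β = δ)]
  rcases Classical.propComplete (α + β = γ + δ) with h | h <;>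
  rcases Classical.propComplete (α = γ ∧ β = δ) with h' | h' <;>
  rcases Classical.propComplete (α = δ ∧ β = γ) with h'' | h'' <;>
  simp only [h, h', h'', if_true, if_false] <;> norm_num

theorem integral_rowFactor_zero {D : ℕ} {α β γ δ : Fin D → ℕ} (hα : α ≠ 0) (hβ : β ≠ 0)
    (hγ : γ ≠ 0) (hδ : δ ≠ 0) :
    ∫ p, rowFactor α β p * conj (rowFactor γ δ p) ∂(torusLaw D).prod (Measure.dirac 0) =
      if α + β = γ + δ then 1 else 0 := by
  rw [Measure.prod_dirac, integral_map (by fun_prop)]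
  · simp only [rowFactor, rowMonomial_at_zero hα, rowMonomial_at_zero hβ, rowMonomial_at_zero hγ,
      rowMonomial_at_zero hδ, add_zero, ← rowMonomial_add]
    exact integral_rowMonomial_mul_conj _ _
  · have := continuous_rowMonomial (D := D)
    unfold rowFactor
    exact Continuous.aestronglyMeasurable (by fun_prop)

/-! ### The form on products of two power sums. -/

theorem LowIdx.ne_zero {N D : ℕ} (α : LowIdx N D) : α.1 ≠ 0 := by
  intro h
  have := α.2.1
  simp [h, deg] at this

theorem LowIdx.two_mul_deg_le {N D : ℕ} (α : LowIdx N D) : 2 * deg α.1 ≤ N := by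
  have := α.2.2
  have h : (2 * deg α.1 : ℝ) ≤ N := by linarith
  exact_mod_cast h

theorem psum_inputMatrix {N D : ℕ} {α : Fin D → ℕ} (hα : α ≠ 0) (y : Fin N → ℂ)
    (q r : Fin D → ℂ) :
    psum α (inputMatrix y q r) = ((1 / Real.sqrt (deg α) : ℝ) : ℂ) *
      ((rowMonomial α q + rowMonomial α r) * powerSum (deg α : ℤ) y) := by
  rw [psum, if_neg hα, Fin.sum_univ_add]
  congr 1
  simp only [inputMatrix, Matrix.of_apply, Fin.append_left, Fin.append_right, mul_pow,
    Finset.prod_mul_distrib, Finset.prod_pow_eq_pow_sum, rowMonomial, powerSum, zpow_natCast, deg,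
    add_mul, Finset.mul_sum, Finset.sum_add_distrib]

theorem integral_integrand_psumPair {N D : ℕ} (ρ : Measure (Fin D → ℂ)) [IsFiniteMeasure ρ]
    (α β γ δ : LowIdx N D) :
    ∫ ω, integrand (psumPair N D s(α, β)) (psumPair N D s(γ, δ)) ω ∂jointLaw N D ρ =
      ((1 / Real.sqrt (deg α.1) * (1 / Real.sqrt (deg β.1)) *
        (1 / Real.sqrt (deg γ.1) * (1 / Real.sqrt (deg δ.1))) : ℝ) : ℂ) *
      ((∫ y, powerSum (deg α.1) y * powerSum (deg β.1) y *
        conj (powerSum (deg γ.1) y * powerSum (deg δ.1) y) ∂vdmLaw N) *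
      ∫ p, rowFactor α.1 β.1 p * conj (rowFactor γ.1 δ.1 p) ∂(torusLaw D).prod ρ) := by
  unfold jointLaw
  rw [← integral_prod_mul, ← integral_const_mul]
  congr 1
  ext ω
  simp only [integrand, psumPair, Sym2.lift_mk, psum_inputMatrix α.ne_zero,
    psum_inputMatrix β.ne_zero, psum_inputMatrix γ.ne_zero, psum_inputMatrix δ.ne_zero, map_mul,
    Complex.conj_ofReal, rowFactor]
  push_cast
  ring

/-- The `[α+β=γ+δ]` terms cancel. The `y`-moment stays unevaluated, as it is only needed when the
pairs coincide. -/
theorem formStar_psumPair {N D : ℕ} (α β γ δ : LowIdx N D) :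
    formStar (psumPair N D s(α, β)) (psumPair N D s(γ, δ)) =
      ((1 / Real.sqrt (deg α.1) * (1 / Real.sqrt (deg β.1)) *
        (1 / Real.sqrt (deg γ.1) * (1 / Real.sqrt (deg δ.1))) : ℝ) : ℂ) *
      (∫ y, powerSum (deg α.1) y * powerSum (deg β.1) y *
        conj (powerSum (deg γ.1) y * powerSum (deg δ.1) y) ∂vdmLaw N) *
      (2 * ((if α = γ ∧ β = δ then 1 else 0) + if α = δ ∧ β = γ then 1 else 0)) := by
  rw [formStar, formA, formA0, integral_integrand_psumPair, integral_integrand_psumPair,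
    integral_rowFactor α.ne_zero β.ne_zero γ.ne_zero δ.ne_zero,
    integral_rowFactor_zero α.ne_zero β.ne_zero γ.ne_zero δ.ne_zero]
  simp only [Subtype.ext_iff]
  ring

theorem formStar_psumPair_of_ne {N D : ℕ} {s t : Sym2 (LowIdx N D)} (h : s ≠ t) :
    formStar (psumPair N D s) (psumPair N D t) = 0 := by
  induction s with | _ α β
  induction t with | _ γ δ
  rw [Ne, Sym2.eq_iff, not_or] at h
  rw [formStar_psumPair, if_neg h.1, if_neg h.2, add_zero, mul_zero, mul_zero]

/-- The first factor is the fourth moment divided by `|α||β|`; the second counts the matchings of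
`(α, β)` with itself. -/
theorem formStar_psumPair_self {N D : ℕ} (α β : LowIdx N D) :
    formStar (psumPair N D s(α, β)) (psumPair N D s(α, β)) =
      (1 + if deg α.1 = deg β.1 then 1 else 0) * (2 * (1 + if α = β then 1 else 0)) := by
  have hN : deg α.1 + deg β.1 ≤ N := by
    have := α.two_mul_deg_le; have := β.two_mul_deg_le; omega
  have ha : (deg α.1 : ℝ) ≠ 0 := by have := α.2.1; positivity
  have hb : (deg β.1 : ℝ) ≠ 0 := by have := β.2.1; positivity
  have hc : (1 / Real.sqrt (deg α.1) * (1 / Real.sqrt (deg β.1)) *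
      (1 / Real.sqrt (deg α.1) * (1 / Real.sqrt (deg β.1))) : ℝ) =
      (deg α.1 : ℝ)⁻¹ * (deg β.1 : ℝ)⁻¹ := by
    have h1 := Real.mul_self_sqrt (Nat.cast_nonneg (α := ℝ) (deg α.1))
    have h2 := Real.mul_self_sqrt (Nat.cast_nonneg (α := ℝ) (deg β.1))
    rw [← h1, ← h2]
    simp only [Real.sqrt_mul_self (Real.sqrt_nonneg _), mul_inv, one_div]
    ring
  have ha' : (deg α.1 : ℂ) ≠ 0 := by exact_mod_cast ha
  have hb' : (deg β.1 : ℂ) ≠ 0 := by exact_mod_cast hb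
  rw [formStar_psumPair, integral_powerSum α.2.1 β.2.1 hN, hc]
  simp only [and_self, if_true, eq_comm (a := β)]
  push_cast
  split_ifs <;> field_simp <;> ring

theorem exists_formStar_psumPair_self {N D : ℕ} (s : Sym2 (LowIdx N D)) :
    ∃ w : ℝ, 0 < w ∧ formStar (psumPair N D s) (psumPair N D s) = w := by
  induction s with | _ α β
  refine ⟨(1 + if deg α.1 = deg β.1 then 1 else 0) * (2 * (1 + if α = β then 1 else 0)),
    by positivity, ?_⟩
  rw [formStar_psumPair_self]
  split_ifs <;> norm_num

/-! ### The span: integrability and sesquilinearity. -/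

theorem range_psumPair (N D : ℕ) : Submodule.span ℂ (Set.range (psumPair N D)) = pairSpan N D := by
  unfold pairSpan
  congr 1
  ext f
  constructor
  · rintro ⟨s, rfl⟩
    induction s with | _ α β
    exact ⟨α, β, rfl⟩
  · rintro ⟨α, β, rfl⟩
    exact ⟨s(α, β), rfl⟩

theorem continuous_of_mem_pairSpan {N D : ℕ} {f : Matrix (Fin D) (Fin (N + N)) ℂ → ℂ}
    (hf : f ∈ pairSpan N D) : Continuous f := by
  have hp : ∀ α : Fin D → ℕ, Continuous (psum α : Matrix (Fin D) (Fin (N + N)) ℂ → ℂ) := by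
    intro α
    unfold psum
    split_ifs
    · exact continuous_const
    · exact continuous_const.mul (continuous_finsetSum _ fun n _ => continuous_finsetProd _
        fun d _ => (continuous_id.matrix_elem d n).pow _)
  induction hf using Submodule.span_induction with
  | mem f h =>
    obtain ⟨α, β, rfl⟩ := h
    exact (hp _).mul (hp _)
  | zero => exact continuous_const
  | add f g _ _ hf hg => exact hf.add hg
  | smul c f _ hf => exact hf.const_smul c

theorem continuous_integrand {N D : ℕ} {f g : Matrix (Fin D) (Fin (N + N)) ℂ → ℂ}
    (hf : f ∈ pairSpan N D) (hg : g ∈ pairSpan N D) : Continuous (integrand f g) := by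
  have hX : Continuous fun ω : (Fin N → ℂ) × (Fin D → ℂ) × (Fin D → ℂ) =>
      inputMatrix ω.1 ω.2.1 ω.2.2 := by
    refine continuous_matrix fun d n => ?_
    refine Fin.addCases (fun n => ?_) (fun n => ?_) n
    · simp only [inputMatrix, Matrix.of_apply, Fin.append_left]
      fun_prop
    · simp only [inputMatrix, Matrix.of_apply, Fin.append_right]
      fun_prop
  exact ((continuous_of_mem_pairSpan hf).comp hX).mul
    (Complex.continuous_conj.comp ((continuous_of_mem_pairSpan hg).comp hX))

theorem integrable_integrand {N D : ℕ} {f g : Matrix (Fin D) (Fin (N + N)) ℂ → ℂ}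
    (hf : f ∈ pairSpan N D) (hg : g ∈ pairSpan N D) :
    Integrable (integrand f g) (jointLaw N D (torusLaw D)) :=
  integrable_of_continuous_of_norm_le_one (ae_jointLaw_norm_le N D _ (ae_torusLaw_norm_le D))
    (continuous_integrand hf hg)

theorem integrable_integrand_zero {N D : ℕ} {f g : Matrix (Fin D) (Fin (N + N)) ℂ → ℂ}
    (hf : f ∈ pairSpan N D) (hg : g ∈ pairSpan N D) :
    Integrable (integrand f g) (jointLaw N D (Measure.dirac 0)) :=
  integrable_of_continuous_of_norm_le_one
    (ae_jointLaw_norm_le N D _ (by rw [ae_dirac_eq]; simp)) (continuous_integrand hf hg)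

theorem formStar_add_left {N D : ℕ} {f f' g : Matrix (Fin D) (Fin (N + N)) ℂ → ℂ}
    (hf : f ∈ pairSpan N D) (hf' : f' ∈ pairSpan N D) (hg : g ∈ pairSpan N D) :
    formStar (f + f') g = formStar f g + formStar f' g := by
  have h : integrand (f + f') g = fun ω => integrand f g ω + integrand f' g ω := by
    ext ω; simp [integrand, add_mul]
  rw [formStar, formA, formA0, h, integral_add (integrable_integrand hf hg)
    (integrable_integrand hf' hg), integral_add (integrable_integrand_zero hf hg)
    (integrable_integrand_zero hf' hg), formStar, formStar, formA, formA0, formA, formA0]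
  ring

theorem formStar_smul_left {N D : ℕ} (c : ℂ) (f g : Matrix (Fin D) (Fin (N + N)) ℂ → ℂ) :
    formStar (c • f) g = c * formStar f g := by
  have h : integrand (c • f) g = fun ω => c * integrand f g ω := by
    ext ω; simp [integrand, mul_assoc]
  rw [formStar, formA, formA0, h, integral_const_mul, integral_const_mul, formStar, formA, formA0]
  ring

theorem conj_formStar {N D : ℕ} (f g : Matrix (Fin D) (Fin (N + N)) ℂ → ℂ) :
    conj (formStar f g) = formStar g f := by
  have h : ∀ ω, conj (integrand f g ω) = integrand g f ω := by
    intro ω; simp [integrand, mul_comm]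
  simp only [formStar, formA, formA0, map_sub, map_mul, ← integral_conj, h, map_ofNat]

theorem formStar_add_right {N D : ℕ} {f g g' : Matrix (Fin D) (Fin (N + N)) ℂ → ℂ}
    (hf : f ∈ pairSpan N D) (hg : g ∈ pairSpan N D) (hg' : g' ∈ pairSpan N D) :
    formStar f (g + g') = formStar f g + formStar f g' := by
  rw [← conj_formStar, formStar_add_left hg hg' hf, map_add, conj_formStar, conj_formStar]

theorem formStar_smul_right {N D : ℕ} (c : ℂ) (f g : Matrix (Fin D) (Fin (N + N)) ℂ → ℂ) :
    formStar f (c • g) = conj c * formStar f g := by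
  rw [← conj_formStar, formStar_smul_left, map_mul, conj_formStar]

/-! ### Basis and positive definiteness. -/

theorem psumPair_mem {N D : ℕ} (s : Sym2 (LowIdx N D)) : psumPair N D s ∈ pairSpan N D := by
  rw [← range_psumPair]
  exact Submodule.subset_span ⟨s, rfl⟩

theorem linearCombination_psumPair_mem {N D : ℕ} (c : Sym2 (LowIdx N D) →₀ ℂ) :
    Finsupp.linearCombination ℂ (psumPair N D) c ∈ pairSpan N D := by
  rw [← range_psumPair]
  exact (Finsupp.mem_span_range_iff_exists_finsupp).mpr ⟨c, rfl⟩

theorem formStar_linearCombination {N D : ℕ} (c : Sym2 (LowIdx N D) →₀ ℂ)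
    {g : Matrix (Fin D) (Fin (N + N)) ℂ → ℂ} (hg : g ∈ pairSpan N D) :
    formStar (Finsupp.linearCombination ℂ (psumPair N D) c) g =
      c.sum fun s x => x * formStar (psumPair N D s) g := by
  induction c using Finsupp.induction_linear with
  | zero =>
    have := formStar_smul_left (0 : ℂ) 0 g
    simpa using this
  | add c c' h h' =>
    rw [map_add, formStar_add_left (linearCombination_psumPair_mem c)
      (linearCombination_psumPair_mem c') hg, h, h',
      Finsupp.sum_add_index' (by simp) (by intros; ring)]
  | single s x =>
    rw [Finsupp.linearCombination_single, formStar_smul_left, Finsupp.sum_single_index (by simp)]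

/-- Orthogonality lets the form read off coefficients, which yields both independence and the
diagonal expression of the form. -/
theorem formStar_linearCombination_psumPair {N D : ℕ} (c : Sym2 (LowIdx N D) →₀ ℂ)
    (t : Sym2 (LowIdx N D)) :
    formStar (Finsupp.linearCombination ℂ (psumPair N D) c) (psumPair N D t) =
      c t * formStar (psumPair N D t) (psumPair N D t) := by
  rw [formStar_linearCombination c (psumPair_mem t), Finsupp.sum_eq_single t]
  · intro s _ hs
    rw [formStar_psumPair_of_ne hs, mul_zero]
  · simp

theorem linearIndependent_psumPair (N D : ℕ) : LinearIndependent ℂ (psumPair N D) := by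
  rw [linearIndependent_iff]
  intro c hc
  ext t
  have h := formStar_linearCombination_psumPair c t
  have h0 : formStar (0 : Matrix (Fin D) (Fin (N + N)) ℂ → ℂ) (psumPair N D t) = 0 := by
    simpa using formStar_smul_left (0 : ℂ) 0 (psumPair N D t)
  obtain ⟨w, hw, hw'⟩ := exists_formStar_psumPair_self t
  rw [hc, h0, hw'] at h
  simpa [hw.ne'] using h.symm

theorem exists_formStar_self {N D : ℕ} (f : pairSpan N D) :
    ∃ x : ℝ, formStar (f : Matrix (Fin D) (Fin (N + N)) ℂ → ℂ) f = x ∧ 0 ≤ x ∧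
      (x = 0 → f = 0) := by
  obtain ⟨f, hf⟩ := f
  obtain ⟨c, rfl⟩ := Finsupp.mem_span_range_iff_exists_finsupp.mp (range_psumPair N D ▸ hf)
  choose w hw hw' using exists_formStar_psumPair_self (N := N) (D := D)
  -- Parseval with weights `w s > 0`, the diagonal values of the form.
  refine ⟨∑ s ∈ c.support, ‖c s‖ ^ 2 * w s, ?_, Finset.sum_nonneg fun s _ =>
    mul_nonneg (sq_nonneg _) (hw s).le, fun h => ?_⟩
  · change formStar (Finsupp.linearCombination ℂ (psumPair N D) c)
      (Finsupp.linearCombination ℂ (psumPair N D) c) = _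
    rw [formStar_linearCombination c (linearCombination_psumPair_mem c), Finsupp.sum, Complex.ofReal_sum]
    refine Finset.sum_congr rfl fun s _ => ?_
    change c s * formStar (psumPair N D s) (Finsupp.linearCombination ℂ (psumPair N D) c) = _
    rw [← conj_formStar, formStar_linearCombination_psumPair, hw', map_mul, ← mul_assoc,
      Complex.mul_conj, Complex.normSq_eq_norm_sq, Complex.conj_ofReal, Complex.ofReal_mul]
  · have hz := (Finset.sum_eq_zero_iff_of_nonneg fun s _ =>
      mul_nonneg (sq_nonneg ‖c s‖) (hw s).le).mp h
    have hc : c = 0 := by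
      ext s
      by_contra hs
      have := hz s (Finsupp.mem_support_iff.mpr hs)
      simp only [mul_eq_zero, (hw s).ne', or_false] at this
      exact hs (by simpa using this)
    subst hc
    ext
    simp

/-- The inner product `⟨·, ·⟩_*` on the span, with the arguments swapped. -/
@[reducible]
noncomputable def starCore (N D : ℕ) : InnerProductSpace.Core ℂ (pairSpan N D) where
  inner g f := formStar (f : Matrix (Fin D) (Fin (N + N)) ℂ → ℂ) g
  conj_inner_symm g f := conj_formStar _ _
  re_inner_nonneg f := by
    obtain ⟨x, hx, h0, -⟩ := exists_formStar_self f
    rw [hx]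
    simpa using h0
  add_left g g' f := formStar_add_right f.2 g.2 g'.2
  smul_left g f c := formStar_smul_right c _ _
  definite f hf := by
    obtain ⟨x, hx, -, h0⟩ := exists_formStar_self f
    exact h0 (by rw [hx] at hf; exact_mod_cast hf)

end MultisymHall

theorem mainTheorem3 (N D : ℕ) :
    -- both expectations exist on the span
    (∀ f ∈ MultisymHall.pairSpan N D, ∀ g ∈ MultisymHall.pairSpan N D,
      MeasureTheory.Integrable (MultisymHall.integrand f g)
        (MultisymHall.jointLaw N D (MultisymHall.torusLaw D)) ∧
      MeasureTheory.Integrable (MultisymHall.integrand f g)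
        (MultisymHall.jointLaw N D (MeasureTheory.Measure.dirac 0))) ∧
    -- the form is an inner product on the span (linear in its first argument, whereas Mathlib's
    -- inner products are linear in the second one)
    (∃ c : InnerProductSpace.Core ℂ (MultisymHall.pairSpan N D),
      ∀ f g : MultisymHall.pairSpan N D,
        c.inner g f = MultisymHall.formStar (f : Matrix (Fin D) (Fin (N + N)) ℂ → ℂ) g) ∧
    -- the products, indexed by unordered pairs, form a basis of the span
    LinearIndependent ℂ (MultisymHall.psumPair N D) ∧
    Submodule.span ℂ (Set.range (MultisymHall.psumPair N D)) = MultisymHall.pairSpan N D ∧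
    -- the form is diagonal in this basis
    (∀ s t : Sym2 (MultisymHall.LowIdx N D), s ≠ t →
      MultisymHall.formStar (MultisymHall.psumPair N D s) (MultisymHall.psumPair N D t) = 0) ∧
    -- the diagonal values are 2, 4 and 8
    (∀ α β : MultisymHall.LowIdx N D,
      (MultisymHall.deg α.1 ≠ MultisymHall.deg β.1 →
        MultisymHall.formStar (MultisymHall.psumPair N D s(α, β))
          (MultisymHall.psumPair N D s(α, β)) = 2) ∧
      (MultisymHall.deg α.1 = MultisymHall.deg β.1 → α ≠ β →
        MultisymHall.formStar (MultisymHall.psumPair N D s(α, β))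
          (MultisymHall.psumPair N D s(α, β)) = 4) ∧
      (α = β →
        MultisymHall.formStar (MultisymHall.psumPair N D s(α, β))
          (MultisymHall.psumPair N D s(α, β)) = 8)) := by
  refine ⟨fun f hf g hg => ⟨MultisymHall.integrable_integrand hf hg,
    MultisymHall.integrable_integrand_zero hf hg⟩, ⟨MultisymHall.starCore N D, fun _ _ => rfl⟩,
    MultisymHall.linearIndependent_psumPair N D, MultisymHall.range_psumPair N D,
    fun _ _ => MultisymHall.formStar_psumPair_of_ne, fun α β => ⟨fun h => ?_, fun h h' => ?_,
    fun h => ?_⟩⟩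
  · have h' : α ≠ β := fun e => h (by rw [e])
    rw [MultisymHall.formStar_psumPair_self, if_neg h, if_neg h']
    norm_num
  · rw [MultisymHall.formStar_psumPair_self, if_pos h, if_neg h']
    norm_num
  · subst h
    rw [MultisymHall.formStar_psumPair_self, if_pos rfl, if_pos rfl]
    norm_num
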